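/- **Martingale Delay Bound (FIFO).** Let $n_1,n_2\in\mathbb{N}$, $n=n_1+n_2$, let $\mu,\lambda,c>0$, and let $Z^{(1)},\dots,Z^{(n)}$ be independent stationary continuous-time Markov chains on $\{0,1\}$ indexed by $t\ge 0$, each with transition rate $\mu$ from $0$ to $1$ and $\lambda$ from $1$ to $0$, started in the steady state, with steady-state "On" probability $p=\frac{\mu}{\lambda+\mu}$. Let $P>0$ be the peak rate, and let $$A_1(t)=\int_0^t P\sum_{i=1}^{n_1}Z^{(i)}(u)\,du,\qquad A_2(t)=\int_0^t P\sum_{i=n_1+1}^{n}Z^{(i)}(u)\,du$$ be the through and the cross aggregate of these Markov-modulated On-Off sub-flows. They share an initially empty, work-conserving server with constant rate $C=nc$ and an infinite buffer, which serves the (infinitesimal) data units in the order of their arrival (FIFO). Let $D_1(t)$ be the cumulative departures of the through aggregate and $$W_1(t)=\inf\{d\ge 0:\ d\le t,\ A_1(t-d)\le D_1(t)\}$$ its virtual delay at time $t\ge 0$. Assume that $\rho:=\frac{pP}{c}<1$ and $P>c$, and set $$K=\rho\left(\frac{\rho-p}{1-p}\right)^{\frac{p}{\rho}-1},\qquad \gamma=\frac{(\lambda+\mu)(1-\rho)}{P-c}.$$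 Then for all $0\le d\le t$ $$\mathbb{P}\bigl(W_1(t)>d\bigr)\le K^n e^{-\gamma C d}.$$ -/

import Mathlib

open MeasureTheory ProbabilityTheory Filter Topology
open scoped NNReal

noncomputable section

namespace FluidQueue

/-- `X` is a continuous-time Markov chain on the finite state space `E`, with generator (matrix of
transition rates) `Q` and initial distribution `ν`: its transition function is
`P_h = exp (h • Q)`, and almost all of its paths are right-continuous with left limits for the
discrete topology of `E`, that is, they have finitely many jumps in every bounded interval. -/
structure IsMarkovChain {Ω E : Type*} [MeasurableSpace Ω] [Fintype E] [DecidableEq E]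
    [MeasurableSpace E] [TopologicalSpace E] [DiscreteTopology E]
    (Q : Matrix E E ℝ) (ν : E → ℝ) (X : ℝ≥0 → Ω → E) (Pr : Measure Ω) : Prop where
  measurable : ∀ t, Measurable (X t)
  finite_dim : ∀ (k : ℕ) (t : Fin (k + 1) → ℝ≥0), t 0 = 0 → Monotone t →
    ∀ x : Fin (k + 1) → E,
      Pr.real {ω | ∀ i, X (t i) ω = x i} =
        ν (x 0) * ∏ i : Fin k,
          NormedSpace.exp (((t i.succ : ℝ) - (t i.castSucc : ℝ)) • Q) (x i.castSucc) (x i.succ)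
  paths : ∀ᵐ ω ∂Pr, ∀ t : ℝ≥0,
    ContinuousWithinAt (fun s => X s ω) (Set.Ici t) t ∧
      ∃ x : E, Tendsto (fun s => X s ω) (𝓝[<] t) (𝓝 x)

/-- Steady-state "On" probability `p` of a two-state chain with rates `0 → 1 : mu` and
`1 → 0 : lam`. -/
def onProb (mu lam : ℝ) : ℝ := mu / (lam + mu)

/-- Generator of the two-state chain with rates `0 → 1 : mu` and `1 → 0 : lam`. -/
def onOffGenerator (mu lam : ℝ) : Matrix (Fin 2) (Fin 2) ℝ :=
  !![-mu, mu; lam, -lam]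

/-- `Z` is the modulating process of a Markov-modulated On-Off source started in steady state. -/
def IsStationaryMMOO {Ω : Type*} [MeasurableSpace Ω] (mu lam : ℝ)
    (Z : ℝ≥0 → Ω → Fin 2) (Pr : Measure Ω) : Prop :=
  IsMarkovChain (onOffGenerator mu lam) ![1 - onProb mu lam, onProb mu lam] Z Pr

/-- Modulating process of an aggregate of On-Off sub-flows: the number of sub-flows that are
"On". -/
def aggregate {Ω : Type*} {m : ℕ} (Z : Fin m → ℝ≥0 → Ω → Fin 2) (t : ℝ≥0) (ω : Ω) : ℕ :=
  ∑ i, (Z i t ω : ℕ)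

/-- Cumulative arrivals `A(t) = ∫₀ᵗ Z(u) P du`, for `t ≥ 0`, of the fluid flow with peak rate
`peak` per sub-flow and modulating process `Z`. -/
def arrivals {Ω : Type*} (peak : ℝ) (Z : ℝ≥0 → Ω → ℕ) (ω : Ω) (t : ℝ) : ℝ :=
  ∫ u in (0 : ℝ)..t, (Z u.toNNReal ω : ℝ) * peak

/-- `D₁`, `D₂` are the cumulative departures, at times `t ≥ 0`, of two fluid flows with cumulative
arrivals `A₁`, `A₂` from an initially empty, work-conserving FIFO server with constant rate `C`
and an infinite buffer. -/
structure IsFIFOServer (C : ℝ) (A₁ A₂ D₁ D₂ : ℝ → ℝ) : Prop where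
  zero₁ : D₁ 0 = 0
  zero₂ : D₂ 0 = 0
  mono₁ : ∀ s t, 0 ≤ s → s ≤ t → D₁ s ≤ D₁ t
  mono₂ : ∀ s t, 0 ≤ s → s ≤ t → D₂ s ≤ D₂ t
  causal₁ : ∀ t, 0 ≤ t → D₁ t ≤ A₁ t
  causal₂ : ∀ t, 0 ≤ t → D₂ t ≤ A₂ t
  /-- The server never works faster than at rate `C`. -/
  capacity : ∀ s t, 0 ≤ s → s ≤ t → (D₁ t + D₂ t) - (D₁ s + D₂ s) ≤ C * (t - s)
  /-- The server works at full rate `C` as long as there is backlog. -/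
  work_conserving : ∀ s t, 0 ≤ s → s ≤ t →
    (∀ u, s < u → u < t → D₁ u + D₂ u < A₁ u + A₂ u) →
      (D₁ t + D₂ t) - (D₁ s + D₂ s) = C * (t - s)
  /-- If some data of flow 1 that arrived up to time `s` is still in the server at time `t`, then
  no data of flow 2 that arrived after time `s` has left by time `t`. -/
  fifo₁ : ∀ s t, 0 ≤ s → 0 ≤ t → D₁ t < A₁ s → D₂ t ≤ A₂ s
  /-- The same with the two flows exchanged. -/
  fifo₂ : ∀ s t, 0 ≤ s → 0 ≤ t → D₂ t < A₂ s → D₁ t ≤ A₁ s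

/-- Virtual delay `W(t) = inf {d ≥ 0 : A(t - d) ≤ D(t)}` at time `t ≥ 0`, where `A` lives on the
time axis `[0, ∞)`. -/
def virtualDelay (A D : ℝ → ℝ) (t : ℝ) : ℝ :=
  sInf {d : ℝ | 0 ≤ d ∧ d ≤ t ∧ A (t - d) ≤ D t}

/-- Utilization factor `ρ = p P / c`. -/
def utilization (mu lam peak c : ℝ) : ℝ := onProb mu lam * peak / c

/-- `K = ρ ((ρ - p) / (1 - p)) ^ (p / ρ - 1)`. -/
def boundK (mu lam peak c : ℝ) : ℝ :=
  utilization mu lam peak c *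
    ((utilization mu lam peak c - onProb mu lam) / (1 - onProb mu lam)) ^
      (onProb mu lam / utilization mu lam peak c - 1)

/-- `γ = (λ + μ) (1 - ρ) / (P - c)`. -/
def boundGamma (mu lam peak c : ℝ) : ℝ :=
  (lam + mu) * (1 - utilization mu lam peak c) / (peak - c)

end FluidQueue

end

/-! ### Transition kernel of the two-state chain. -/

namespace FluidQueue

/-! If the through delay at time t exceeds d, some through data that arrived by t - d is still
queued at t, so by FIFO no cross data that arrived after t - d has left. The total departures up to
t are then below the total arrivals up to T = t - d, and since the server is work-conserving the
aggregate backlog at T exceeds Cd (`IsFIFOServer.exists_lt_of_lt_virtualDelay`). It remains to bound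
by K^n e^(-γa) the probability that A(s,T) - C(T-s) > a for some s ≤ T, where A is the aggregate
input (`measureReal_backlog_le`).

Let r = `onWeight` and h = (1, r). Then Qh + γ diag(zP - c) h = 0, so, the chains being reversible,
r^(number On at s) e^(γ(A(s,T) - C(T-s))) is a martingale when s runs backwards from T. Where the
excess first crosses a, the input rate is at least nc, hence r^(number On) ≥ r^(nc/P). Optional
stopping gives (E[r^Z] / r^(c/P))^n e^(-γa), and the base is K (`boundK_eq`).

The argument is carried out on a grid of mesh T/(m+1), where induction along the Lindley recursion
replaces optional stopping (`IsDiscreteMarkovChain.measureReal_lindley_inter_le`). Each step costs a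
factor whose first-order term vanishes by the choice of h, so the accumulated factor tends to 1
(`tendsto_growthBound_pow`). Right-continuity of the paths brings the bound back to continuous time
(`eventually_exists_lt_sum_Ico`). -/

theorem exp_smul_onOffGenerator {mu lam : ℝ} (h : lam + mu ≠ 0) (x : ℝ) :
    NormedSpace.exp (x • onOffGenerator mu lam) =
      1 + ((1 - Real.exp (-((lam + mu) * x))) / (lam + mu)) • onOffGenerator mu lam := by
  have hdet : (!![1, mu; 1, -lam] : Matrix (Fin 2) (Fin 2) ℝ).det = -(lam + mu) := by
    rw [Matrix.det_fin_two_of]; ring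
  have hU : IsUnit (!![1, mu; 1, -lam] : Matrix (Fin 2) (Fin 2) ℝ) := by
    rw [Matrix.isUnit_iff_isUnit_det, hdet]
    exact (neg_ne_zero.mpr h).isUnit
  have hinv : (!![1, mu; 1, -lam] : Matrix (Fin 2) (Fin 2) ℝ)⁻¹ =
      !![lam / (lam + mu), mu / (lam + mu); 1 / (lam + mu), -1 / (lam + mu)] := by
    refine Matrix.inv_eq_right_inv ?_
    ext i j
    fin_cases i <;> fin_cases j <;> simp [Matrix.mul_apply, Fin.sum_univ_two] <;> field_simp <;> ring
  have hdiag : ∀ a b : ℝ, Matrix.diagonal ![a, b] = !![a, 0; 0, b] := by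
    intro a b
    ext i j
    fin_cases i <;> fin_cases j <;> simp
  have hexp : NormedSpace.exp ![0, -((lam + mu) * x)] = ![1, Real.exp (-((lam + mu) * x))] := by
    ext i
    fin_cases i <;> simp [← Real.exp_eq_exp_ℝ]
  -- The columns (1, 1) and (μ, -λ) are eigenvectors of the generator for the eigenvalues 0 and -(λ
  -- + μ).
  have hconj : x • onOffGenerator mu lam =
      !![1, mu; 1, -lam] * Matrix.diagonal ![0, -((lam + mu) * x)] * !![1, mu; 1, -lam]⁻¹ := by
    rw [hinv, onOffGenerator, hdiag]
    ext i j
    fin_cases i <;> fin_cases j <;> simp <;> field_simp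
  rw [hconj, Matrix.exp_conj _ _ hU, Matrix.exp_diagonal, hinv, onOffGenerator, hexp, hdiag]
  ext i j
  fin_cases i <;> fin_cases j <;> simp <;> field_simp <;> ring

/-- Transition probabilities over a time `x` of the two-state chain with rates `0 → 1 : mu` and
`1 → 0 : lam`. -/
noncomputable def onOffKernel (mu lam x : ℝ) : Matrix (Fin 2) (Fin 2) ℝ :=
  NormedSpace.exp (x • onOffGenerator mu lam)

theorem onOffKernel_eq {mu lam : ℝ} (h : lam + mu ≠ 0) (x : ℝ) :
    onOffKernel mu lam x =
      let k := (1 - Real.exp (-((lam + mu) * x))) / (lam + mu)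
      !![1 - k * mu, k * mu; k * lam, 1 - k * lam] := by
  rw [onOffKernel, exp_smul_onOffGenerator h, onOffGenerator]
  ext i j
  fin_cases i <;> fin_cases j <;> simp <;> ring

theorem onOffKernel_nonneg {mu lam x : ℝ} (hmu : 0 < mu) (hlam : 0 < lam) (hx : 0 ≤ x)
    (i j : Fin 2) : 0 ≤ onOffKernel mu lam x i j := by
  have ha : 0 < lam + mu := by positivity
  have h1 : Real.exp (-((lam + mu) * x)) ≤ 1 := Real.exp_le_one_iff.mpr (by
    have := mul_nonneg ha.le hx; linarith)
  have h2 := Real.exp_pos (-((lam + mu) * x))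
  have h3 : (1 - Real.exp (-((lam + mu) * x))) / (lam + mu) * mu ≤ 1 := by
    rw [div_mul_eq_mul_div, div_le_one ha]; nlinarith
  have h4 : (1 - Real.exp (-((lam + mu) * x))) / (lam + mu) * lam ≤ 1 := by
    rw [div_mul_eq_mul_div, div_le_one ha]; nlinarith
  have h5 : 0 ≤ (1 - Real.exp (-((lam + mu) * x))) / (lam + mu) :=
    div_nonneg (by linarith) ha.le
  rw [onOffKernel_eq ha.ne']
  fin_cases i <;> fin_cases j <;> simp <;> first | positivity | linarith

theorem sum_onOffKernel {mu lam : ℝ} (h : lam + mu ≠ 0) (x : ℝ) (i : Fin 2) :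
    ∑ j, onOffKernel mu lam x i j = 1 := by
  rw [onOffKernel_eq h]
  fin_cases i <;> simp [Fin.sum_univ_two]

/-- Stationary distribution of the two-state chain. -/
noncomputable def onOffDist (mu lam : ℝ) : Fin 2 → ℝ :=
  ![1 - onProb mu lam, onProb mu lam]

theorem onOffDist_nonneg {mu lam : ℝ} (hmu : 0 < mu) (hlam : 0 < lam) (i : Fin 2) :
    0 ≤ onOffDist mu lam i := by
  have ha : 0 < lam + mu := by positivity
  have h1 : onProb mu lam ≤ 1 := by
    rw [onProb, div_le_one ha]; linarith
  have h2 : 0 ≤ onProb mu lam := by rw [onProb]; positivity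
  fin_cases i <;> simp [onOffDist, h1, h2]

theorem onOffKernel_reversible {mu lam : ℝ} (h : lam + mu ≠ 0) (x : ℝ) (i j : Fin 2) :
    onOffDist mu lam i * onOffKernel mu lam x i j =
      onOffDist mu lam j * onOffKernel mu lam x j i := by
  rw [onOffKernel_eq h, onOffDist, onProb]
  fin_cases i <;> fin_cases j <;> simp <;> field_simp <;> ring

/-- Weight of the "On" state in the exponential martingale of a single source. -/
noncomputable def onWeight (mu lam peak c : ℝ) : ℝ := lam * c / (mu * (peak - c))

/-! ### Algebra of the constants r, γ and K. -/

section Constants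

variable {mu lam peak c : ℝ}

/-- Stability: ρ < 1 amounts to μ(P - c) < λc. -/
theorem one_lt_onWeight (hmu : 0 < mu) (hlam : 0 < lam) (hc : 0 < c) (hpeak : c < peak)
    (hρ : utilization mu lam peak c < 1) : 1 < onWeight mu lam peak c := by
  have ha : 0 < lam + mu := by positivity
  have hP : 0 < peak - c := by linarith
  rw [utilization, onProb, div_lt_one hc, div_mul_eq_mul_div, div_lt_iff₀ ha] at hρ
  rw [onWeight, one_lt_div (by positivity)]
  linarith

theorem boundGamma_nonneg (hmu : 0 < mu) (hlam : 0 < lam) (hpeak : c < peak)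
    (hρ : utilization mu lam peak c < 1) : 0 ≤ boundGamma mu lam peak c := by
  rw [boundGamma]
  exact div_nonneg (mul_nonneg (by positivity) (by linarith)) (by linarith)

/-- This and `boundGamma_mul_excess` are the "Off" and "On" coordinates of Qh + γ diag(zP - c) h = 0
for h = (1, r). -/
theorem boundGamma_mul_capacity (hmu : 0 < mu) (hlam : 0 < lam) (hc : 0 < c) (hpeak : c < peak) :
    boundGamma mu lam peak c * c = mu * (onWeight mu lam peak c - 1) := by
  have ha : lam + mu ≠ 0 := by positivity
  have hP : peak - c ≠ 0 := by linarith
  rw [boundGamma, utilization, onProb, onWeight]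
  field_simp
  ring

theorem boundGamma_mul_excess (hmu : 0 < mu) (hlam : 0 < lam) (hc : 0 < c) (hpeak : c < peak) :
    onWeight mu lam peak c * (boundGamma mu lam peak c * (peak - c)) =
      lam * (onWeight mu lam peak c - 1) := by
  have ha : lam + mu ≠ 0 := by positivity
  have hP : peak - c ≠ 0 := by linarith
  rw [boundGamma, utilization, onProb, onWeight]
  field_simp
  ring

/-- Exhibits K as the stationary mean of r^Z over the least weight per source at an overshoot. It
rests on (ρ - p)/(1 - p) = 1/r, p/ρ = c/P and 1 - p + pr = ρr. -/
theorem boundK_eq (hmu : 0 < mu) (hlam : 0 < lam) (hc : 0 < c) (hpeak : c < peak) :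
    boundK mu lam peak c =
      (1 - onProb mu lam + onProb mu lam * onWeight mu lam peak c) /
        onWeight mu lam peak c ^ (c / peak) := by
  have ha : lam + mu ≠ 0 := by positivity
  have hP : 0 < peak - c := by linarith
  have hpk : 0 < peak := by linarith
  have hr : 0 < onWeight mu lam peak c := by rw [onWeight]; positivity
  have h1 : (utilization mu lam peak c - onProb mu lam) / (1 - onProb mu lam) =
      (onWeight mu lam peak c)⁻¹ := by
    have : 1 - onProb mu lam = lam / (lam + mu) := by rw [onProb]; field_simp; ring
    rw [this, utilization, onProb, onWeight]
    field_simp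
  have h2 : onProb mu lam / utilization mu lam peak c = c / peak := by
    rw [utilization, onProb]; field_simp
  have h3 : 1 - onProb mu lam + onProb mu lam * onWeight mu lam peak c =
      utilization mu lam peak c * onWeight mu lam peak c := by
    rw [utilization, onProb, onWeight]
    field_simp
    ring
  rw [boundK, h1, h2, h3, Real.inv_rpow hr.le, ← Real.rpow_neg hr.le, neg_sub,
    Real.rpow_sub hr, Real.rpow_one, mul_div_assoc]

end Constants

/-! ### One-step error of the discretized martingale. -/

/-- One-step growth factor, over a time `x`, of the exponential martingale of a single source that
is "Off", respectively "On", at the start. -/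
noncomputable def growth (mu lam peak c x : ℝ) (z : Fin 2) : ℝ :=
  (∑ z', onOffKernel mu lam x z z' * onWeight mu lam peak c ^ (z' : ℕ)) *
    Real.exp (boundGamma mu lam peak c * (x * ((z : ℕ) * peak - c)))

/-- The derivative at 0 is a coordinate of Qh + γ diag(zP - c) h, hence zero. -/
theorem hasDerivAt_growth {mu lam peak c : ℝ} (hmu : 0 < mu) (hlam : 0 < lam) (hc : 0 < c)
    (hpeak : c < peak) (z : Fin 2) :
    HasDerivAt (fun x => growth mu lam peak c x z) 0 0 := by
  have ha : lam + mu ≠ 0 := by positivity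
  have hk : HasDerivAt (fun x => (1 - Real.exp (-((lam + mu) * x))) / (lam + mu)) 1 0 := by
    have := ((((hasDerivAt_id (0 : ℝ)).const_mul (lam + mu)).neg.exp).const_sub 1).div_const
      (lam + mu)
    exact this.congr_deriv (by simp [ha])
  have he : ∀ v : ℝ, HasDerivAt (fun x => Real.exp (boundGamma mu lam peak c * (x * v)))
      (boundGamma mu lam peak c * v) 0 := by
    intro v
    have := ((((hasDerivAt_id (0 : ℝ)).mul_const v).const_mul (boundGamma mu lam peak c)).exp)
    exact this.congr_deriv (by simp)
  fin_cases z
  · have hd := ((hk.mul_const (mu * (onWeight mu lam peak c - 1))).const_add 1).mul (he (-c))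
    refine (hd.congr_deriv ?_).congr_of_eventuallyEq (Eventually.of_forall fun x => ?_)
    · have := boundGamma_mul_capacity hmu hlam hc hpeak
      simp
      linarith
    · simp [growth, onOffKernel_eq ha, Fin.sum_univ_two]
      ring
  · have hd := ((hk.mul_const (lam * (1 - onWeight mu lam peak c))).const_add
      (onWeight mu lam peak c)).mul (he (peak - c))
    refine (hd.congr_deriv ?_).congr_of_eventuallyEq (Eventually.of_forall fun x => ?_)
    · have := boundGamma_mul_excess hmu hlam hc hpeak
      simp
      linarith
    · simp [growth, onOffKernel_eq ha, Fin.sum_univ_two]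
      ring

theorem growth_zero {mu lam peak c : ℝ} (h : lam + mu ≠ 0) (z : Fin 2) :
    growth mu lam peak c 0 z = onWeight mu lam peak c ^ (z : ℕ) := by
  rw [growth, onOffKernel_eq h]
  fin_cases z <;> simp [Fin.sum_univ_two]

/-- Upper bound of the relative growth of the exponential martingale of a single source. -/
noncomputable def growthBound (mu lam peak c x : ℝ) : ℝ :=
  1 + ∑ z, |growth mu lam peak c x z - onWeight mu lam peak c ^ (z : ℕ)|

theorem one_le_growthBound (mu lam peak c x : ℝ) : 1 ≤ growthBound mu lam peak c x := by
  rw [growthBound]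
  have : 0 ≤ ∑ z, |growth mu lam peak c x z - onWeight mu lam peak c ^ (z : ℕ)| := by positivity
  linarith

/-- Since r^z ≥ 1, the absolute error also serves as a relative one. -/
theorem growth_le {mu lam peak c : ℝ} (hr : 1 < onWeight mu lam peak c) (x : ℝ) (z : Fin 2) :
    growth mu lam peak c x z ≤
      growthBound mu lam peak c x * onWeight mu lam peak c ^ (z : ℕ) := by
  have h1 : 1 ≤ onWeight mu lam peak c ^ (z : ℕ) := one_le_pow₀ hr.le
  have h2 : |growth mu lam peak c x z - onWeight mu lam peak c ^ (z : ℕ)| ≤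
      ∑ z, |growth mu lam peak c x z - onWeight mu lam peak c ^ (z : ℕ)| :=
    Finset.single_le_sum (f := fun z : Fin 2 =>
      |growth mu lam peak c x z - onWeight mu lam peak c ^ (z : ℕ)|)
      (fun _ _ => abs_nonneg _) (Finset.mem_univ z)
  have h3 := le_abs_self (growth mu lam peak c x z - onWeight mu lam peak c ^ (z : ℕ))
  have h4 := abs_nonneg (growth mu lam peak c x z - onWeight mu lam peak c ^ (z : ℕ))
  rw [growthBound]
  nlinarith

/-- By `hasDerivAt_growth` the error per step is o(1/m), and m + 1 steps accumulate o(1); 1 + u ≤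
e^u makes this an upper bound. -/
theorem tendsto_growthBound_pow {mu lam peak c : ℝ} (hmu : 0 < mu) (hlam : 0 < lam) (hc : 0 < c)
    (hpeak : c < peak) (n : ℕ) {T : ℝ} (hT : T ≠ 0) :
    Tendsto (fun m : ℕ => (growthBound mu lam peak c (T / (m + 1)) ^ n) ^ (m + 1)) atTop (𝓝 1) := by
  have ha : lam + mu ≠ 0 := by positivity
  have hx : Tendsto (fun m : ℕ => T / ((m : ℝ) + 1)) atTop (𝓝[≠] 0) := by
    refine tendsto_nhdsWithin_iff.mpr ⟨?_, Eventually.of_forall fun m => ?_⟩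
    · have := (tendsto_one_div_add_atTop_nhds_zero_nat (𝕜 := ℝ)).const_mul T
      simpa [div_eq_mul_inv] using this
    · exact div_ne_zero hT (by positivity)
  have hz : ∀ z, Tendsto (fun m : ℕ => ((m : ℝ) + 1) *
      |growth mu lam peak c (T / (m + 1)) z - onWeight mu lam peak c ^ (z : ℕ)|) atTop (𝓝 0) := by
    intro z
    have h1 := ((hasDerivAt_growth hmu hlam hc hpeak z).tendsto_slope_zero.comp hx).abs.const_mul |T|
    rw [abs_zero, mul_zero] at h1
    refine h1.congr fun m => ?_
    have hm : (0 : ℝ) < m + 1 := by positivity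
    have hT' : |T| ≠ 0 := abs_ne_zero.mpr hT
    simp only [Function.comp, zero_add, growth_zero ha, smul_eq_mul, abs_mul, abs_inv, abs_div,
      abs_of_pos hm]
    field_simp
  have hlim : Tendsto (fun m : ℕ => Real.exp (n * ∑ z, ((m : ℝ) + 1) *
      |growth mu lam peak c (T / (m + 1)) z - onWeight mu lam peak c ^ (z : ℕ)|)) atTop (𝓝 1) := by
    have := (Real.continuous_exp.tendsto _).comp
      ((tendsto_finsetSum Finset.univ fun z _ => hz z).const_mul (n : ℝ))
    simpa [Function.comp_def] using this
  refine tendsto_of_tendsto_of_tendsto_of_le_of_le tendsto_const_nhds hlim (fun m => ?_) fun m => ?_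
  · exact one_le_pow₀ (one_le_pow₀ (one_le_growthBound _ _ _ _ _))
  · have h1 : growthBound mu lam peak c (T / (m + 1)) ≤
        Real.exp (growthBound mu lam peak c (T / (m + 1)) - 1) := by
      have := Real.add_one_le_exp (growthBound mu lam peak c (T / (m + 1)) - 1)
      linarith
    have h0 := (zero_le_one.trans (one_le_growthBound mu lam peak c (T / (m + 1))))
    dsimp only
    rw [← pow_mul]
    refine (pow_le_pow_left₀ h0 h1 _).trans (le_of_eq ?_)
    rw [← Real.exp_nat_mul, growthBound, ← Finset.mul_sum]
    push_cast
    congr 1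
    ring

end FluidQueue

/-! ### Lindley recursion driven by a reversible discrete-time chain. -/

namespace FluidQueue

/-- Lindley recursion: the workload of a discrete-time queue with net input `f (x k)` in the
`k`-th slot. -/
noncomputable def lindley {S : Type*} (f : S → ℝ) (x : ℕ → S) : ℕ → ℝ
  | 0 => 0
  | k + 1 => max 0 (lindley f x k + f (x (k + 1)))

theorem lindley_nonneg {S : Type*} (f : S → ℝ) (x : ℕ → S) (k : ℕ) : 0 ≤ lindley f x k := by
  cases k with
  | zero => exact le_rfl
  | succ k => exact le_max_left _ _

theorem lindley_congr {S : Type*} (f : S → ℝ) {x y : ℕ → S} {k : ℕ} (h : ∀ i ≤ k, x i = y i) :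
    lindley f x k = lindley f y k := by
  induction k with
  | zero => rfl
  | succ k ih => rw [lindley, lindley, ih fun i hi => h i (by omega), h (k + 1) le_rfl]

theorem sum_Ico_le_lindley {S : Type*} (f : S → ℝ) (x : ℕ → S) {k m : ℕ} (h : k ≤ m) :
    ∑ i ∈ Finset.Ico k m, f (x (i + 1)) ≤ lindley f x m := by
  induction m, h using Nat.le_induction with
  | base => simpa using lindley_nonneg f x k
  | succ m hm ih =>
    rw [Finset.sum_Ico_succ_top hm, lindley]
    exact le_max_of_le_right (by gcongr)

/-- `X` is a Markov chain in discrete time with transition matrix `P`. -/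
structure IsDiscreteMarkovChain {Ω S : Type*} [MeasurableSpace Ω] (P : S → S → ℝ)
    (X : ℕ → Ω → S) (Pr : Measure Ω) : Prop where
  measurableSet : ∀ k y, MeasurableSet {ω | X k ω = y}
  markov : ∀ (k : ℕ) (v : Fin (k + 1) → S) (y : S),
    Pr.real ({ω | ∀ i : Fin (k + 1), X i ω = v i} ∩ {ω | X (k + 1) ω = y}) =
      Pr.real {ω | ∀ i : Fin (k + 1), X i ω = v i} * P (v (Fin.last k)) y

namespace IsDiscreteMarkovChain

variable {Ω S : Type*} [MeasurableSpace Ω] {Pr : Measure Ω}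
  {P : S → S → ℝ} {X : ℕ → Ω → S}

theorem measurableSet_path (hX : IsDiscreteMarkovChain P X Pr) (k : ℕ) (v : Fin k → S) :
    MeasurableSet {ω | ∀ i : Fin k, X i ω = v i} := by
  rw [Set.ofPred_forall]
  exact MeasurableSet.iInter fun i => hX.measurableSet _ _

variable [IsProbabilityMeasure Pr] [Fintype S]

/-- The Markov property is postulated for single past trajectories; an event of the past is a finite
disjoint union of them. -/
theorem measureReal_past_inter (hX : IsDiscreteMarkovChain P X Pr) (k : ℕ)
    (A : Set (Fin (k + 1) → S)) (y' y : S) :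
    Pr.real {ω | (fun i : Fin (k + 1) => X i ω) ∈ A ∧ X k ω = y' ∧ X (k + 1) ω = y} =
      Pr.real {ω | (fun i : Fin (k + 1) => X i ω) ∈ A ∧ X k ω = y'} * P y' y := by
  classical
  set V : Ω → Fin (k + 1) → S := fun ω i => X i ω
  set s : Finset (Fin (k + 1) → S) := {v | v ∈ A ∧ v (Fin.last k) = y'} with hs
  have hVs : ∀ v, V ⁻¹' {v} = {ω | ∀ i : Fin (k + 1), X i ω = v i} := by
    intro v
    ext ω
    simp [V, funext_iff]
  have hV : ∀ v ∈ s, MeasurableSet (V ⁻¹' {v}) := by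
    intro v _
    rw [hVs]
    exact hX.measurableSet_path _ v
  have hVm : MeasurableSet (V ⁻¹' (s : Set (Fin (k + 1) → S))) := by
    rw [← Set.biUnion_preimage_singleton]
    exact Finset.measurableSet_biUnion s hV
  have h1 : {ω | V ω ∈ A ∧ X k ω = y'} = V ⁻¹' (s : Set (Fin (k + 1) → S)) := by
    ext ω
    simp [hs, V]
  have h2 : {ω | V ω ∈ A ∧ X k ω = y' ∧ X (k + 1) ω = y} =
      V ⁻¹' (s : Set (Fin (k + 1) → S)) ∩ {ω | X (k + 1) ω = y} := by
    ext ω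
    simp [hs, V, and_assoc]
  rw [h1, h2, ← measureReal_restrict_apply hVm, ← sum_measureReal_preimage_singleton s hV,
    ← sum_measureReal_preimage_singleton s hV, Finset.sum_mul]
  refine Finset.sum_congr rfl fun v hv => ?_
  rw [measureReal_restrict_apply (hV v hv), hVs, hX.markov]
  rw [hs, Finset.mem_filter] at hv
  rw [hv.2.2]

theorem measureReal_eq_sum (hX : IsDiscreteMarkovChain P X Pr) (k : ℕ) (A : Set Ω) :
    Pr.real A = ∑ y, Pr.real (A ∩ {ω | X k ω = y}) := by
  have h := sum_measureReal_preimage_singleton (μ := Pr.restrict A) (Finset.univ : Finset S)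
    (f := X k) fun y _ => hX.measurableSet k y
  rw [Finset.coe_univ, Set.preimage_univ, measureReal_restrict_apply MeasurableSet.univ,
    Set.univ_inter] at h
  rw [← h]
  refine Finset.sum_congr rfl fun y _ => ?_
  rw [Set.inter_comm]
  exact measureReal_restrict_apply (hX.measurableSet k y)

theorem measureReal_lindley_succ (hX : IsDiscreteMarkovChain P X Pr) (f : S → ℝ) (k : ℕ) (a : ℝ)
    (y : S) :
    Pr.real {ω | a < lindley f (X · ω) k ∧ X (k + 1) ω = y} =
      ∑ y', Pr.real {ω | a < lindley f (X · ω) k ∧ X k ω = y'} * P y' y := by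
  rw [hX.measureReal_eq_sum k]
  refine Finset.sum_congr rfl fun y' _ => ?_
  have h := hX.measureReal_past_inter k
    {v | a < lindley f (fun i => v (Fin.ofNat (k + 1) i)) k} y' y
  -- `Fin.ofNat` wraps indices beyond k around, which is harmless: the workload at k depends only on
  -- the indices up to k.
  have hl : ∀ ω, lindley f (fun i => X (Fin.ofNat (k + 1) i) ω) k = lindley f (X · ω) k := by
    refine fun ω => lindley_congr f fun i hi => ?_
    simp [Nat.mod_eq_of_lt (Nat.lt_succ_of_le hi)]
  simp only [Set.mem_ofPred_eq, hl] at h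
  rw [← h]
  congr 1
  ext ω
  simp only [Set.mem_inter_iff, Set.mem_ofPred_eq]
  tauto

theorem measureReal_succ (hX : IsDiscreteMarkovChain P X Pr) (k : ℕ) (y : S) :
    Pr.real {ω | X (k + 1) ω = y} = ∑ y', Pr.real {ω | X k ω = y'} * P y' y := by
  rw [hX.measureReal_eq_sum k]
  refine Finset.sum_congr rfl fun y' _ => ?_
  have h := hX.measureReal_past_inter k Set.univ y' y
  simp only [Set.mem_univ, true_and] at h
  rw [← h]
  congr 1
  ext ω
  simp [and_comm]

variable {π : S → ℝ}

theorem measureReal_eq_of_reversible (hX : IsDiscreteMarkovChain P X Pr)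
    (hrev : ∀ y y', π y * P y y' = π y' * P y' y) (hsum : ∀ y, ∑ y', P y y' = 1)
    (h0 : ∀ y, Pr.real {ω | X 0 ω = y} = π y) (k : ℕ) (y : S) :
    Pr.real {ω | X k ω = y} = π y := by
  induction k generalizing y with
  | zero => exact h0 y
  | succ k ih => simp_rw [hX.measureReal_succ, ih, hrev _ y, ← Finset.mul_sum, hsum, mul_one]

/-- Exponential bound of the workload of a queue in discrete time whose input is modulated by a
reversible stationary Markov chain. -/
theorem measureReal_lindley_inter_le (hX : IsDiscreteMarkovChain P X Pr)
    (hP : ∀ y y', 0 ≤ P y y') (hπ : ∀ y, 0 ≤ π y)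
    (hrev : ∀ y y', π y * P y y' = π y' * P y' y) (hsum : ∀ y, ∑ y', P y y' = 1)
    (h0 : ∀ y, Pr.real {ω | X 0 ω = y} = π y) {f G : S → ℝ} {θ E M F : ℝ} (hθ : 0 ≤ θ)
    (hE : 1 ≤ E) (hM : 0 < M) (hG : ∀ y, 0 ≤ G y) (hGM : ∀ y, 0 < f y → M ≤ G y)
    (hF : ∀ y, f y ≤ F)
    (hstep : ∀ y, (∑ y', P y y' * G y') * Real.exp (θ * f y) ≤ E * G y)
    (k : ℕ) {a : ℝ} (ha : 0 ≤ a) (y : S) :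
    Pr.real {ω | a < lindley f (X · ω) k ∧ X k ω = y} ≤
      π y * (E ^ k * G y * Real.exp (θ * (F - a)) / M) := by
  induction k generalizing a y with
  | zero =>
    have : {ω | a < lindley f (X · ω) 0 ∧ X 0 ω = y} = ∅ := by
      ext ω
      simp [lindley, ha.not_gt]
    rw [this, measureReal_empty]
    have := hG y
    have := hπ y
    positivity
  | succ k ih =>
    -- If the last slot alone exceeds a, then f y > 0, so M ≤ G y and the claimed bound is already
    -- at least π y. Otherwise a - f y ≥ 0 and the induction hypothesis applies at that level.
    rcases lt_or_ge a (f y) with hay | hay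
    · calc Pr.real {ω | a < lindley f (X · ω) (k + 1) ∧ X (k + 1) ω = y}
          ≤ Pr.real {ω | X (k + 1) ω = y} := measureReal_mono fun ω hω => hω.2
        _ = π y * 1 := by rw [hX.measureReal_eq_of_reversible hrev hsum h0, mul_one]
        _ ≤ _ := by
          refine mul_le_mul_of_nonneg_left ?_ (hπ y)
          rw [one_le_div hM]
          have h1 : 1 ≤ E ^ (k + 1) := one_le_pow₀ hE
          have h2 : 1 ≤ Real.exp (θ * (F - a)) :=
            Real.one_le_exp (mul_nonneg hθ (by have := hF y; linarith))
          have h3 := hGM y (ha.trans_lt hay)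
          calc M ≤ G y := h3
            _ ≤ E ^ (k + 1) * G y := le_mul_of_one_le_left (hG y) h1
            _ ≤ _ := le_mul_of_one_le_right (mul_nonneg (by positivity) (hG y)) h2
    · have heq : {ω | a < lindley f (X · ω) (k + 1) ∧ X (k + 1) ω = y} =
          {ω | a - f y < lindley f (X · ω) k ∧ X (k + 1) ω = y} := by
        ext ω
        simp only [Set.mem_ofPred_eq, lindley, lt_max_iff, ha.not_gt, false_or]
        refine and_congr_left fun h => ?_
        rw [h, sub_lt_iff_lt_add]
      rw [heq, hX.measureReal_lindley_succ]
      calc ∑ y', Pr.real {ω | a - f y < lindley f (X · ω) k ∧ X k ω = y'} * P y' y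
          ≤ ∑ y', π y' * (E ^ k * G y' * Real.exp (θ * (F - (a - f y))) / M) * P y' y :=
            Finset.sum_le_sum fun y' _ =>
              mul_le_mul_of_nonneg_right (ih (by linarith) y') (hP y' y)
        -- Detailed balance reverses the transition, so that P acts on G as `hstep` requires.
        _ = π y * (E ^ k * ((∑ y', P y y' * G y') * Real.exp (θ * f y)) *
              Real.exp (θ * (F - a)) / M) := by
            have hexp : Real.exp (θ * (F - (a - f y))) =
                Real.exp (θ * f y) * Real.exp (θ * (F - a)) := by
              rw [← Real.exp_add]; ring_nf
            simp only [Finset.sum_mul, Finset.mul_sum, Finset.sum_div]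
            refine Finset.sum_congr rfl fun y' _ => ?_
            rw [hexp]
            linear_combination (E ^ k * G y' * (Real.exp (θ * f y) * Real.exp (θ * (F - a))) / M) *
              hrev y' y
        _ ≤ π y * (E ^ k * (E * G y) * Real.exp (θ * (F - a)) / M) := by
            have := hstep y
            have := hπ y
            gcongr
        _ = _ := by rw [pow_succ]; ring

theorem measureReal_lindley_le (hX : IsDiscreteMarkovChain P X Pr)
    (hP : ∀ y y', 0 ≤ P y y') (hπ : ∀ y, 0 ≤ π y)
    (hrev : ∀ y y', π y * P y y' = π y' * P y' y) (hsum : ∀ y, ∑ y', P y y' = 1)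
    (h0 : ∀ y, Pr.real {ω | X 0 ω = y} = π y) {f G : S → ℝ} {θ E M F : ℝ} (hθ : 0 ≤ θ)
    (hE : 1 ≤ E) (hM : 0 < M) (hG : ∀ y, 0 ≤ G y) (hGM : ∀ y, 0 < f y → M ≤ G y)
    (hF : ∀ y, f y ≤ F)
    (hstep : ∀ y, (∑ y', P y y' * G y') * Real.exp (θ * f y) ≤ E * G y)
    (k : ℕ) {a : ℝ} (ha : 0 ≤ a) :
    Pr.real {ω | a < lindley f (X · ω) k} ≤
      E ^ k * Real.exp (θ * (F - a)) * ((∑ y, π y * G y) / M) := by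
  rw [hX.measureReal_eq_sum k]
  refine (Finset.sum_le_sum fun y _ => hX.measureReal_lindley_inter_le hP hπ hrev hsum h0 hθ hE hM
    hG hGM hF hstep k ha y).trans (le_of_eq ?_)
  rw [Finset.sum_div, Finset.mul_sum]
  refine Finset.sum_congr rfl fun y _ => ?_
  ring

end IsDiscreteMarkovChain

end FluidQueue

/-! ### Discretization of right-continuous inputs. -/

namespace FluidQueue

/-- Rounding up approaches u from the right, so right-continuity suffices for convergence of the
sampled path. -/
theorem tendsto_ceil_mul_div (u : ℝ) {T : ℝ} (hT : 0 < T) (hu : 0 ≤ u) :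
    Tendsto (fun m : ℕ => (⌈u / (T / (m + 1))⌉₊ : ℝ) * (T / (m + 1))) atTop (𝓝[≥] u) := by
  have hδ : ∀ m : ℕ, 0 < T / ((m : ℝ) + 1) := fun m => by positivity
  have hle : ∀ m : ℕ, u ≤ (⌈u / (T / (m + 1))⌉₊ : ℝ) * (T / (m + 1)) := fun m => by
    rw [← div_le_iff₀ (hδ m)]
    exact Nat.le_ceil _
  refine tendsto_nhdsWithin_iff.mpr ⟨?_, Eventually.of_forall hle⟩
  have hlim : Tendsto (fun m : ℕ => u + T / ((m : ℝ) + 1)) atTop (𝓝 u) := by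
    have := ((tendsto_one_div_add_atTop_nhds_zero_nat (𝕜 := ℝ)).const_mul T).const_add u
    simpa [div_eq_mul_inv] using this
  refine tendsto_of_tendsto_of_tendsto_of_le_of_le tendsto_const_nhds hlim hle fun m => ?_
  have h1 := (Nat.ceil_lt_add_one (div_nonneg hu (hδ m).le)).le
  have h2 := mul_le_mul_of_nonneg_right h1 (hδ m).le
  rwa [add_mul, one_mul, div_mul_cancel₀ _ (hδ m).ne'] at h2

theorem measurable_comp_ceil (F : ℝ → ℝ) (x : ℝ) :
    Measurable fun u : ℝ => F (⌈u / x⌉₊ * x) :=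
  (measurable_from_top (f := fun k : ℕ => F (k * x))).comp
    (Nat.measurable_ceil.comp (measurable_id.div_const x))

section RightContinuous

variable {F : ℝ → ℝ} {B : ℝ}

theorem aestronglyMeasurable_of_rightContinuous
    (hF : ∀ u, 0 ≤ u → ContinuousWithinAt F (Set.Ici u) u) (s t : ℝ) (hs : 0 ≤ s) :
    AEStronglyMeasurable F (volume.restrict (Set.Ioc s t)) := by
  refine aestronglyMeasurable_of_tendsto_ae atTop
    (fun m : ℕ => (measurable_comp_ceil F (1 / ((m : ℝ) + 1))).aestronglyMeasurable) ?_
  refine (ae_restrict_iff' measurableSet_Ioc).mpr (ae_of_all _ fun u hu => ?_)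
  have h0 : 0 ≤ u := hs.trans hu.1.le
  exact (hF u h0).tendsto.comp (tendsto_ceil_mul_div u one_pos h0)

theorem intervalIntegrable_of_rightContinuous
    (hF : ∀ u, 0 ≤ u → ContinuousWithinAt F (Set.Ici u) u) (hB : ∀ u, |F u| ≤ B) {s t : ℝ}
    (hs : 0 ≤ s) (hst : s ≤ t) : IntervalIntegrable F volume s t := by
  rw [intervalIntegrable_iff_integrableOn_Ioc_of_le hst]
  exact Integrable.of_bound (aestronglyMeasurable_of_rightContinuous hF s t hs) B (ae_of_all _ hB)

theorem tendsto_integral_comp_ceil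
    (hF : ∀ u, 0 ≤ u → ContinuousWithinAt F (Set.Ici u) u) (hB : ∀ u, |F u| ≤ B) {s T : ℝ}
    (hs : 0 ≤ s) (hsT : s ≤ T) (hT : 0 < T) :
    Tendsto (fun m : ℕ => ∫ u in s..T, F (⌈u / (T / (m + 1))⌉₊ * (T / (m + 1)))) atTop
      (𝓝 (∫ u in s..T, F u)) := by
  refine intervalIntegral.tendsto_integral_filter_of_dominated_convergence (fun _ => B)
    (Eventually.of_forall fun m => (measurable_comp_ceil F _).aestronglyMeasurable)
    (Eventually.of_forall fun m => ae_of_all _ fun u _ => hB _) (by simp)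
    (ae_of_all _ fun u hu => ?_)
  rw [Set.uIoc_of_le hsT] at hu
  have h0 : 0 ≤ u := hs.trans hu.1.le
  exact (hF u h0).tendsto.comp (tendsto_ceil_mul_div u hT h0)

theorem integral_comp_ceil_eq_sum (F : ℝ → ℝ) {x : ℝ} (hx : 0 < x) {k m : ℕ} (hkm : k ≤ m) :
    ∫ u in (k * x)..(m * x), F (⌈u / x⌉₊ * x) = ∑ i ∈ Finset.Ico k m, x * F ((i + 1 : ℕ) * x) := by
  have hpiece : ∀ i : ℕ, ∀ u ∈ Set.uIoc ((i : ℝ) * x) ((i + 1 : ℕ) * x),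
      F (⌈u / x⌉₊ * x) = F ((i + 1 : ℕ) * x) := by
    intro i u hu
    rw [Set.uIoc_of_le (by push_cast; nlinarith)] at hu
    have : ⌈u / x⌉₊ = i + 1 := by
      rw [Nat.ceil_eq_iff (Nat.succ_ne_zero i)]
      refine ⟨?_, ?_⟩
      · rw [Nat.succ_sub_one, lt_div_iff₀ hx]; exact hu.1
      · rw [div_le_iff₀ hx]; exact hu.2
    rw [this]
  rw [← intervalIntegral.sum_integral_adjacent_intervals_Ico (a := fun i : ℕ => (i : ℝ) * x) hkm]
  · refine Finset.sum_congr rfl fun i _ => ?_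
    rw [intervalIntegral.integral_congr_ae (ae_of_all _ (hpiece i)),
      intervalIntegral.integral_const, smul_eq_mul]
    push_cast
    ring
  · intro i _
    exact (intervalIntegrable_const (c := F ((i + 1 : ℕ) * x))).congr fun u hu => (hpiece i u hu).symm

/-- If the net input `F - C` of a fluid queue over some interval `[s, T]` exceeds `a`, so does that
of every sufficiently fine discretization. -/
theorem eventually_exists_lt_sum_Ico
    (hF : ∀ u, 0 ≤ u → ContinuousWithinAt F (Set.Ici u) u) (hF0 : ∀ u, 0 ≤ F u)
    (hB : ∀ u, F u ≤ B) {C a s T : ℝ} (hs : 0 ≤ s) (hsT : s ≤ T) (hT : 0 < T)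
    (h : a < (∫ u in s..T, F u) - C * (T - s)) (hC : 0 ≤ C) :
    ∀ᶠ m : ℕ in atTop, ∃ k ≤ m + 1,
      a < ∑ i ∈ Finset.Ico k (m + 1),
        T / (m + 1) * (F ((i + 1 : ℕ) * (T / (m + 1))) - C) := by
  have hB' : ∀ u, |F u| ≤ B := fun u => by rw [abs_of_nonneg (hF0 u)]; exact hB u
  have hlim : Tendsto (fun m : ℕ =>
      (∫ u in s..T, F (⌈u / (T / (m + 1))⌉₊ * (T / (m + 1)))) - C * (T - s + T / (m + 1))) atTop
      (𝓝 ((∫ u in s..T, F u) - C * (T - s))) := by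
    refine (tendsto_integral_comp_ceil hF hB' hs hsT hT).sub ?_
    have := ((((tendsto_one_div_add_atTop_nhds_zero_nat (𝕜 := ℝ)).const_mul T).const_add
      (T - s)).const_mul C)
    simpa [div_eq_mul_inv] using this
  filter_upwards [hlim.eventually_const_lt h] with m hm
  set x : ℝ := T / (m + 1) with hx
  have hx0 : 0 < x := by positivity
  have hTx : ((m + 1 : ℕ) : ℝ) * x = T := by rw [hx]; push_cast; field_simp
  -- Rounding s down to the grid only adds nonnegative input and costs at most Cx of extra service,
  -- the term already allowed for in `hlim`.
  set k := ⌊s / x⌋₊ with hk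
  have hks : (k : ℝ) * x ≤ s := by
    rw [← le_div_iff₀ hx0]; exact Nat.floor_le (div_nonneg hs hx0.le)
  have hsk : s ≤ k * x + x := by
    have := (Nat.lt_floor_add_one (s / x)).le
    rw [div_le_iff₀ hx0] at this
    linarith
  have hkm : k ≤ m + 1 := by
    have h1 : (k : ℝ) * x ≤ ((m + 1 : ℕ) : ℝ) * x := by rw [hTx]; linarith
    exact_mod_cast le_of_mul_le_mul_right h1 hx0
  refine ⟨k, hkm, hm.trans_le ?_⟩
  have hint : ∀ p q : ℝ, IntervalIntegrable (fun u => F (⌈u / x⌉₊ * x)) volume p q := by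
    intro p q
    rw [intervalIntegrable_iff]
    exact Measure.integrableOn_of_bounded (M := B) (by simp)
      (measurable_comp_ceil F _).aestronglyMeasurable (ae_of_all _ fun u => hB' _)
  have h1 := integral_comp_ceil_eq_sum F hx0 hkm
  rw [hTx] at h1
  have h2 := intervalIntegral.integral_add_adjacent_intervals (hint (k * x) s) (hint s T)
  have h3 : 0 ≤ ∫ u in (k * x)..s, F (⌈u / x⌉₊ * x) :=
    intervalIntegral.integral_nonneg hks fun u _ => hF0 _
  have h4 : ∑ i ∈ Finset.Ico k (m + 1), x * (F ((i + 1 : ℕ) * x) - C) =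
      ∑ i ∈ Finset.Ico k (m + 1), x * F ((i + 1 : ℕ) * x) - C * (T - k * x) := by
    simp only [mul_sub, Finset.sum_sub_distrib, Finset.sum_const, Nat.card_Ico, nsmul_eq_mul]
    rw [← hTx]
    push_cast [Nat.cast_sub hkm]
    ring
  rw [h4, ← h1, ← h2]
  have h5 : C * (T - k * x) ≤ C * (T - s + x) := mul_le_mul_of_nonneg_left (by linarith) hC
  linarith

end RightContinuous

/-! ### Deterministic analysis of the FIFO server. -/

/-- The total departures from an initially empty, work-conserving server with constant rate `C`
are at least the arrivals convolved with the service curve `C`. -/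
theorem IsFIFOServer.exists_add_le {C : ℝ} {A₁ A₂ D₁ D₂ : ℝ → ℝ}
    (h : IsFIFOServer C A₁ A₂ D₁ D₂) (h1 : A₁ 0 = 0) (h2 : A₂ 0 = 0) {t : ℝ} (ht : 0 ≤ t)
    (hA : ContinuousOn (fun u => A₁ u + A₂ u) (Set.Icc 0 t)) :
    ∃ s, 0 ≤ s ∧ s ≤ t ∧ A₁ s + A₂ s + C * (t - s) ≤ D₁ t + D₂ t := by
  set U : Set ℝ := {u | 0 ≤ u ∧ u ≤ t ∧ A₁ u + A₂ u ≤ D₁ u + D₂ u} with hU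
  have hne : U.Nonempty := ⟨0, le_rfl, ht, by rw [h1, h2, h.zero₁, h.zero₂]⟩
  have hbdd : BddAbove U := ⟨t, fun u hu => hu.2.1⟩
  -- The last instant up to t at which the queue is empty; from then on the server works at full
  -- rate.
  set s := sSup U with hs
  have hs0 : 0 ≤ s := le_csSup_of_le hbdd hne.choose_spec hne.choose_spec.1
  have hst : s ≤ t := csSup_le hne fun u hu => hu.2.1
  -- The supremum is attained because arrivals are continuous and departures are monotone.
  have hAs : A₁ s + A₂ s ≤ D₁ s + D₂ s := by
    obtain ⟨v, -, hv, hvU⟩ := exists_seq_tendsto_sSup hne hbdd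
    have hlim : Tendsto (fun k => A₁ (v k) + A₂ (v k)) atTop (𝓝 (A₁ s + A₂ s)) :=
      (hA s ⟨hs0, hst⟩).tendsto.comp (tendsto_nhdsWithin_iff.mpr
        ⟨hv, Eventually.of_forall fun k => ⟨(hvU k).1, (hvU k).2.1⟩⟩)
    refine le_of_tendsto hlim (Eventually.of_forall fun k => ?_)
    have hk := le_csSup hbdd (hvU k)
    have := h.mono₁ (v k) s (hvU k).1 hk
    have := h.mono₂ (v k) s (hvU k).1 hk
    have := (hvU k).2.2
    linarith
  refine ⟨s, hs0, hst, ?_⟩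
  have := h.work_conserving s t hs0 hst fun u hu hut => by
    by_contra hcon
    exact hu.not_ge (le_csSup hbdd ⟨hs0.trans hu.le, hut.le, not_lt.mp hcon⟩)
  linarith

/-- If the virtual delay of flow 1 at time `t` exceeds `d` then the backlog at time `t - d` exceeds
`C * d`. -/
theorem IsFIFOServer.exists_lt_of_lt_virtualDelay {C : ℝ} {A₁ A₂ D₁ D₂ : ℝ → ℝ}
    (h : IsFIFOServer C A₁ A₂ D₁ D₂) (h1 : A₁ 0 = 0) (h2 : A₂ 0 = 0) (hC : 0 ≤ C)
    (hmono : ∀ u v, 0 ≤ u → u ≤ v → A₁ u + A₂ u ≤ A₁ v + A₂ v) {t d : ℝ}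
    (hA : ContinuousOn (fun u => A₁ u + A₂ u) (Set.Icc 0 t)) (hd : 0 ≤ d) (hdt : d ≤ t)
    (hlt : d < virtualDelay A₁ D₁ t) :
    ∃ s, 0 ≤ s ∧ s ≤ t - d ∧
      C * d < A₁ (t - d) + A₂ (t - d) - (A₁ s + A₂ s) - C * (t - d - s) := by
  have ht : 0 ≤ t := hd.trans hdt
  have hdep : D₁ t < A₁ (t - d) := by
    by_contra hcon
    exact hlt.not_ge (csInf_le ⟨0, fun e he => he.1⟩ ⟨hd, hdt, not_lt.mp hcon⟩)
  have hdep2 := h.fifo₁ (t - d) t (by linarith) ht hdep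
  obtain ⟨s, hs0, hst, hs⟩ := h.exists_add_le h1 h2 ht hA
  have hCs : 0 ≤ C * (t - s) := mul_nonneg hC (by linarith)
  refine ⟨s, hs0, ?_, ?_⟩
  -- If s came after t - d, the total arrivals at s would be at least those at t - d, which exceed
  -- the departures at t, contrary to the choice of s.
  · by_contra hcon
    have := hmono (t - d) s (by linarith) (not_le.mp hcon).le
    linarith
  · have : C * (t - d - s) = C * (t - s) - C * d := by ring
    linarith

end FluidQueue

/-! ### Backlog tail bound for independent On-Off sources. -/

namespace FluidQueue

/-- A is almost surely contained in the lower limit of the B m. Continuity from below holds for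
arbitrary sets under the outer measure, so no measurability is needed. -/
theorem measureReal_le_of_ae_eventually_mem {Ω : Type*} [MeasurableSpace Ω] {Pr : Measure Ω}
    [IsProbabilityMeasure Pr] {A : Set Ω} {B : ℕ → Set Ω} {b : ℕ → ℝ} {l : ℝ}
    (h : ∀ᵐ ω ∂Pr, ω ∈ A → ∀ᶠ m in atTop, ω ∈ B m) (hb : ∀ m, Pr.real (B m) ≤ b m)
    (hl : Tendsto b atTop (𝓝 l)) : Pr.real A ≤ l := by
  have hA : Pr.real A ≤ Pr.real (⋃ N : ℕ, ⋂ m ≥ N, B m) := by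
    refine ENNReal.toReal_mono (measure_ne_top _ _) (measure_mono_ae ?_)
    filter_upwards [h] with ω hω hωA
    obtain ⟨N, hN⟩ := eventually_atTop.mp (hω hωA)
    exact Set.mem_iUnion.mpr ⟨N, Set.mem_iInter₂.mpr hN⟩
  have hmono : Monotone fun N : ℕ => ⋂ m ≥ N, B m := fun N N' hN =>
    Set.biInter_mono (fun m hm => le_trans hN hm) fun m _ => le_rfl
  have hlim := (ENNReal.tendsto_toReal (measure_ne_top Pr _)).comp
    (tendsto_measure_iUnion_atTop (μ := Pr) hmono)
  refine hA.trans (le_of_tendsto' hlim fun N => ?_)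
  refine ge_of_tendsto hl (eventually_atTop.mpr ⟨N, fun m hm => ?_⟩)
  exact (measureReal_mono (Set.biInter_subset_of_mem hm)).trans (hb m)

section Sources

variable {Ω ι : Type*} [MeasurableSpace Ω] {Pr : Measure Ω} [Fintype ι]
  {mu lam peak c : ℝ} {Z : ι → ℝ≥0 → Ω → Fin 2}

theorem IsStationaryMMOO.measureReal_path {Y : ℝ≥0 → Ω → Fin 2} (hY : IsStationaryMMOO mu lam Y Pr)
    (x : ℝ≥0) (k : ℕ) (v : Fin (k + 1) → Fin 2) :
    Pr.real {ω | ∀ j : Fin (k + 1), Y ((j : ℕ) * x) ω = v j} =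
      onOffDist mu lam (v 0) * ∏ j : Fin k, onOffKernel mu lam x (v j.castSucc) (v j.succ) := by
  have h := hY.finite_dim k (fun j => (j : ℕ) * x) (by simp)
    (fun i j hij => mul_le_mul_of_nonneg_right (by exact_mod_cast hij) zero_le) v
  rw [h, onOffDist]
  refine congrArg₂ _ rfl (Finset.prod_congr rfl fun j _ => ?_)
  have hstep : (((j.succ : ℕ) * x : ℝ≥0) : ℝ) - ((j.castSucc : ℕ) * x : ℝ≥0) = x := by
    push_cast [Fin.val_succ, Fin.val_castSucc]
    ring
  rw [onOffKernel, hstep]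

theorem measureReal_joint_path [IsProbabilityMeasure Pr] (hZ : ∀ i, IsStationaryMMOO mu lam (Z i) Pr)
    (hindep : iIndepFun (fun i ω (t : ℝ≥0) => Z i t ω) Pr) (x : ℝ≥0) (k : ℕ)
    (v : Fin (k + 1) → ι → Fin 2) :
    Pr.real {ω | ∀ j : Fin (k + 1), (fun i => Z i ((j : ℕ) * x) ω) = v j} =
      (∏ i, onOffDist mu lam (v 0 i)) *
        ∏ j : Fin k, ∏ i, onOffKernel mu lam x (v j.castSucc i) (v j.succ i) := by
  set B : ι → Set (ℝ≥0 → Fin 2) := fun i => {z | ∀ j : Fin (k + 1), z ((j : ℕ) * x) = v j i}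
  have hB : ∀ i ∈ Finset.univ, MeasurableSet (B i) := by
    intro i _
    simp only [B, Set.ofPred_forall]
    exact MeasurableSet.iInter fun j =>
      measurableSet_eq_fun (measurable_pi_apply _) measurable_const
  have h := (iIndepFun_iff_measure_inter_preimage_eq_mul.mp hindep) Finset.univ hB
  have hset : {ω | ∀ j : Fin (k + 1), (fun i => Z i ((j : ℕ) * x) ω) = v j} =
      ⋂ i ∈ Finset.univ, (fun ω (t : ℝ≥0) => Z i t ω) ⁻¹' B i := by
    ext ω
    simp only [Set.mem_ofPred_eq, funext_iff, Finset.mem_univ, Set.iInter_true, Set.mem_iInter,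
      Set.mem_preimage, B]
    exact forall_comm
  rw [hset, measureReal_def, h, ENNReal.toReal_prod, Finset.prod_comm, ← Finset.prod_mul_distrib]
  exact Finset.prod_congr rfl fun i _ => (hZ i).measureReal_path x k fun j => v j i

/-- The state is the whole vector of sources rather than the number that are "On", so that kernel,
stationary law and weight all factor over the sources. -/
theorem isDiscreteMarkovChain_sources [IsProbabilityMeasure Pr]
    (hZ : ∀ i, IsStationaryMMOO mu lam (Z i) Pr)
    (hindep : iIndepFun (fun i ω (t : ℝ≥0) => Z i t ω) Pr) (x : ℝ≥0) :
    IsDiscreteMarkovChain (fun y y' : ι → Fin 2 => ∏ i, onOffKernel mu lam x (y i) (y' i))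
      (fun k ω i => Z i (k * x) ω) Pr where
  measurableSet k y := by
    simp only [funext_iff, Set.ofPred_forall]
    exact MeasurableSet.iInter fun i =>
      measurableSet_eq_fun ((hZ i).measurable _) measurable_const
  markov k v y := by
    have hset : {ω | ∀ j : Fin (k + 1), (fun i => Z i ((j : ℕ) * x) ω) = v j} ∩
        {ω | (fun i => Z i ((k + 1 : ℕ) * x) ω) = y} =
        {ω | ∀ j : Fin (k + 1 + 1), (fun i => Z i ((j : ℕ) * x) ω) =
          Fin.snoc (α := fun _ => ι → Fin 2) v y j} := by
      ext ω
      simp [Fin.forall_fin_succ']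
    rw [hset, measureReal_joint_path hZ hindep, measureReal_joint_path hZ hindep,
      Fin.prod_univ_castSucc, mul_assoc]
    have h0 : Fin.snoc (α := fun _ => ι → Fin 2) v y 0 = v 0 := by
      rw [← Fin.castSucc_zero, Fin.snoc_castSucc]
    simp only [Fin.snoc_castSucc, h0, Fin.succ_castSucc, Fin.succ_last, Fin.snoc_last]

theorem continuousWithinAt_source {Y : ℝ≥0 → Fin 2}
    (hY : ∀ t, ContinuousWithinAt Y (Set.Ici t) t) (u : ℝ) :
    ContinuousWithinAt (fun u : ℝ => ((Y u.toNNReal : ℕ) : ℝ)) (Set.Ici u) u := by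
  have h1 : ContinuousWithinAt (fun u : ℝ => Y u.toNNReal) (Set.Ici u) u :=
    (hY u.toNNReal).comp continuous_real_toNNReal.continuousWithinAt
      fun w hw => Real.toNNReal_le_toNNReal hw
  exact (continuous_of_discreteTopology (f := fun z : Fin 2 => ((z : ℕ) : ℝ))).continuousAt.comp_continuousWithinAt h1

/-- Instantaneous arrival rate of an aggregate of On-Off sources. -/
noncomputable def inputRate (peak : ℝ) (Z : ι → ℝ≥0 → Ω → Fin 2) (ω : Ω) (u : ℝ) : ℝ :=
  (∑ i, ((Z i u.toNNReal ω : ℕ) : ℝ)) * peak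

omit [MeasurableSpace Ω] in
theorem continuousWithinAt_inputRate {ω : Ω}
    (h : ∀ i t, ContinuousWithinAt (fun s => Z i s ω) (Set.Ici t) t) (u : ℝ) :
    ContinuousWithinAt (inputRate peak Z ω) (Set.Ici u) u :=
  (tendsto_finsetSum _ fun i _ => continuousWithinAt_source (h i) u).mul_const peak

theorem sum_le_card (y : ι → Fin 2) : ∑ i, ((y i : ℕ) : ℝ) ≤ Fintype.card ι := by
  refine (Finset.sum_le_card_nsmul Finset.univ (fun i => ((y i : ℕ) : ℝ)) 1 fun i _ => ?_).trans
    (by simp)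
  exact_mod_cast Nat.le_of_lt_succ (y i).isLt

omit [MeasurableSpace Ω] in
theorem inputRate_nonneg (hp : 0 ≤ peak) (ω : Ω) (u : ℝ) : 0 ≤ inputRate peak Z ω u :=
  mul_nonneg (Finset.sum_nonneg fun _ _ => Nat.cast_nonneg _) hp

omit [MeasurableSpace Ω] in
theorem inputRate_le (hp : 0 ≤ peak) (ω : Ω) (u : ℝ) :
    inputRate peak Z ω u ≤ Fintype.card ι * peak :=
  mul_le_mul_of_nonneg_right (sum_le_card _) hp

omit [MeasurableSpace Ω] in
theorem abs_inputRate_le (hp : 0 ≤ peak) (ω : Ω) (u : ℝ) :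
    |inputRate peak Z ω u| ≤ Fintype.card ι * peak := by
  rw [abs_of_nonneg (inputRate_nonneg hp ω u)]
  exact inputRate_le hp ω u

theorem sum_onOffDist_mul_pow [DecidableEq ι] (r : ℝ) :
    ∑ y : ι → Fin 2, (∏ i, onOffDist mu lam (y i)) * ∏ i, r ^ (y i : ℕ) =
      (1 - onProb mu lam + onProb mu lam * r) ^ Fintype.card ι := by
  simp_rw [← Finset.prod_mul_distrib]
  rw [← Fintype.prod_sum fun (_ : ι) (z : Fin 2) => onOffDist mu lam z * r ^ (z : ℕ)]
  simp [onOffDist, Fin.sum_univ_two]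

theorem measureReal_discretized_le [IsProbabilityMeasure Pr] (hmu : 0 < mu) (hlam : 0 < lam)
    (hc : 0 < c) (hZ : ∀ i, IsStationaryMMOO mu lam (Z i) Pr)
    (hindep : iIndepFun (fun i ω (t : ℝ≥0) => Z i t ω) Pr)
    (hρ : utilization mu lam peak c < 1) (hpeak : c < peak) (x : ℝ≥0) (m : ℕ) {a : ℝ}
    (ha : 0 ≤ a) :
    Pr.real {ω | ∃ k ≤ m, a < ∑ i ∈ Finset.Ico k m,
        x * (inputRate peak Z ω ((i + 1 : ℕ) * x) - Fintype.card ι * c)} ≤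
      (growthBound mu lam peak c x ^ Fintype.card ι) ^ m *
        Real.exp (boundGamma mu lam peak c * (x * (Fintype.card ι * peak) - a)) *
          boundK mu lam peak c ^ Fintype.card ι := by
  classical
  set n := Fintype.card ι with hn
  set r := onWeight mu lam peak c with hr
  have hr1 : 1 < r := one_lt_onWeight hmu hlam hc hpeak hρ
  have hpk : 0 < peak := hc.trans hpeak
  have hne : lam + mu ≠ 0 := by positivity
  have hX := isDiscreteMarkovChain_sources hZ hindep x
  set f : (ι → Fin 2) → ℝ := fun y => x * ((∑ i, ((y i : ℕ) : ℝ)) * peak - n * c) with hf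
  have hbound := hX.measureReal_lindley_le (π := fun y => ∏ i, onOffDist mu lam (y i)) (f := f)
    (G := fun y => ∏ i, r ^ (y i : ℕ)) (θ := boundGamma mu lam peak c)
    (E := growthBound mu lam peak c x ^ n) (M := (r ^ (c / peak)) ^ n) (F := x * (n * peak))
    (fun y y' => Finset.prod_nonneg fun i _ => onOffKernel_nonneg hmu hlam x.2 _ _)
    (fun y => Finset.prod_nonneg fun i _ => onOffDist_nonneg hmu hlam _)
    (fun y y' => by
      rw [← Finset.prod_mul_distrib, ← Finset.prod_mul_distrib]
      exact Finset.prod_congr rfl fun i _ => onOffKernel_reversible hne _ _ _)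
    (fun y => by
      rw [← Fintype.prod_sum fun (i : ι) (z : Fin 2) => onOffKernel mu lam x (y i) z]
      exact Finset.prod_eq_one fun i _ => sum_onOffKernel hne _ _)
    (fun y => by
      have := measureReal_joint_path hZ hindep x 0 fun _ => y
      simpa using this)
    (boundGamma_nonneg hmu hlam hpeak hρ) (one_le_pow₀ (one_le_growthBound _ _ _ _ _))
    (by positivity) (fun y => by positivity)
    -- Positive net input forces the number of "On" sources above nc/P, whence the choice of M.
    (fun y hy => by
      have hpos : 0 < (∑ i, ((y i : ℕ) : ℝ)) * peak - n * c := pos_of_mul_pos_right hy x.2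
      rw [Finset.prod_pow_eq_pow_sum, ← Real.rpow_natCast, ← Real.rpow_natCast,
        ← Real.rpow_mul (by positivity)]
      refine Real.rpow_le_rpow_of_exponent_le hr1.le ?_
      push_cast
      rw [div_mul_eq_mul_div, div_le_iff₀ hpk]
      linarith)
    (fun y => by
      refine mul_le_mul_of_nonneg_left ?_ x.2
      have h1 := mul_le_mul_of_nonneg_right (sum_le_card y) hpk.le
      have h2 : 0 ≤ (n : ℝ) * c := by positivity
      linarith)
    -- Kernel, weight and exponential are all products over the sources, which reduces the step to
    -- `growth_le` for each source.
    (fun y => by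
      have hexp : Real.exp (boundGamma mu lam peak c * f y) =
          ∏ i, Real.exp (boundGamma mu lam peak c * (x * ((y i : ℕ) * peak - c))) := by
        rw [← Real.exp_sum, ← Finset.mul_sum, ← Finset.mul_sum, Finset.sum_sub_distrib,
          ← Finset.sum_mul]
        simp [hf, hn]
      simp_rw [← Finset.prod_mul_distrib]
      rw [← Fintype.prod_sum fun (i : ι) (z : Fin 2) => onOffKernel mu lam x (y i) z * r ^ (z : ℕ),
        hexp, ← Finset.prod_mul_distrib, hn, ← Finset.card_univ, ← Finset.prod_const,
        ← Finset.prod_mul_distrib]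
      refine Finset.prod_le_prod (fun i _ => ?_) fun i _ => growth_le hr1 x (y i)
      exact mul_nonneg (Finset.sum_nonneg fun z _ =>
        mul_nonneg (onOffKernel_nonneg hmu hlam x.2 _ _) (by positivity)) (Real.exp_pos _).le)
    m ha
  rw [sum_onOffDist_mul_pow, ← div_pow, ← boundK_eq hmu hlam hc hpeak] at hbound
  refine (measureReal_mono ?_).trans hbound
  rintro ω ⟨k, hkm, hk⟩
  refine hk.trans_le (le_trans (le_of_eq ?_)
    (sum_Ico_le_lindley f (fun k i => Z i (k * x) ω) hkm))
  refine Finset.sum_congr rfl fun i _ => ?_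
  simp only [hf, inputRate]
  rw [Real.toNNReal_mul (Nat.cast_nonneg _), Real.toNNReal_natCast, Real.toNNReal_coe]

/-- Exponential tail bound of the stationary backlog of a fluid queue fed by On-Off sources. -/
theorem measureReal_backlog_le [IsProbabilityMeasure Pr] (hmu : 0 < mu) (hlam : 0 < lam)
    (hc : 0 < c) (hZ : ∀ i, IsStationaryMMOO mu lam (Z i) Pr)
    (hindep : iIndepFun (fun i ω (t : ℝ≥0) => Z i t ω) Pr)
    (hρ : utilization mu lam peak c < 1) (hpeak : c < peak) {T a : ℝ} (hT : 0 < T)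
    (ha : 0 ≤ a) :
    Pr.real {ω | ∃ s, 0 ≤ s ∧ s ≤ T ∧
        a < (∫ u in s..T, inputRate peak Z ω u) - Fintype.card ι * c * (T - s)} ≤
      boundK mu lam peak c ^ Fintype.card ι * Real.exp (-(boundGamma mu lam peak c * a)) := by
  have hpk : 0 < peak := hc.trans hpeak
  refine measureReal_le_of_ae_eventually_mem ?_
    (fun m => measureReal_discretized_le hmu hlam hc hZ hindep hρ hpeak
      (T / (m + 1)).toNNReal (m + 1) ha) ?_
  · filter_upwards [ae_all_iff.mpr fun i => (hZ i).paths] with ω hω hmem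
    obtain ⟨s, hs, hsT, hlt⟩ := hmem
    have hev := eventually_exists_lt_sum_Ico
      (fun u _ => continuousWithinAt_inputRate (fun i t => (hω i t).1) u)
      (inputRate_nonneg hpk.le ω) (inputRate_le hpk.le ω) hs hsT hT hlt (by positivity)
    filter_upwards [hev] with m hm
    rwa [Real.coe_toNNReal _ (by positivity)]
  -- As the mesh vanishes, both the accumulated error and the overshoot allowance x·nP disappear
  -- from the bound.
  · have h1 := tendsto_growthBound_pow hmu hlam hc hpeak (Fintype.card ι) hT.ne'
    have h2 : Tendsto (fun m : ℕ => T / ((m : ℝ) + 1)) atTop (𝓝 0) := by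
      have := (tendsto_one_div_add_atTop_nhds_zero_nat (𝕜 := ℝ)).const_mul T
      simpa [div_eq_mul_inv] using this
    have h3 := (Real.continuous_exp.tendsto _).comp
      (((h2.mul_const (Fintype.card ι * peak)).sub_const a).const_mul (boundGamma mu lam peak c))
    have h4 := (h1.mul h3).mul_const (boundK mu lam peak c ^ Fintype.card ι)
    have h5 : (1 * Real.exp (boundGamma mu lam peak c * (0 * (Fintype.card ι * peak) - a))) *
        boundK mu lam peak c ^ Fintype.card ι =
        boundK mu lam peak c ^ Fintype.card ι * Real.exp (-(boundGamma mu lam peak c * a)) := by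
      rw [one_mul, mul_comm]
      ring_nf
    rw [← h5]
    refine h4.congr fun m => ?_
    rw [Real.coe_toNNReal _ (by positivity)]
    rfl

end Sources

end FluidQueue

/-! ### From the through delay to the aggregate backlog. -/

theorem mainTheorem2 {Ω : Type*} [MeasurableSpace Ω] (Pr : Measure Ω) [IsProbabilityMeasure Pr]
    (n₁ n₂ : ℕ) (mu lam peak c : ℝ) (hmu : 0 < mu) (hlam : 0 < lam) (hc : 0 < c)
    (Z : Fin n₁ ⊕ Fin n₂ → ℝ≥0 → Ω → Fin 2)
    (hZ : ∀ i, FluidQueue.IsStationaryMMOO mu lam (Z i) Pr)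
    (hindep : iIndepFun (fun i ω (t : ℝ≥0) => Z i t ω) Pr)
    (hρ : FluidQueue.utilization mu lam peak c < 1) (hpeak : c < peak)
    (A₁ A₂ D₁ D₂ : Ω → ℝ → ℝ)
    (hA₁ : A₁ = FluidQueue.arrivals peak (FluidQueue.aggregate fun i => Z (Sum.inl i)))
    (hA₂ : A₂ = FluidQueue.arrivals peak (FluidQueue.aggregate fun i => Z (Sum.inr i)))
    (C : ℝ) (hC : C = ((n₁ + n₂ : ℕ) : ℝ) * c)
    (hserver : ∀ᵐ ω ∂Pr, FluidQueue.IsFIFOServer C (A₁ ω) (A₂ ω) (D₁ ω) (D₂ ω))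
    (t d : ℝ) (hd : 0 ≤ d) (hdt : d ≤ t) :
    Pr.real {ω | d < FluidQueue.virtualDelay (A₁ ω) (D₁ ω) t} ≤
      FluidQueue.boundK mu lam peak c ^ (n₁ + n₂) *
        Real.exp (-(FluidQueue.boundGamma mu lam peak c * C * d)) := by
  have hpk : 0 < peak := hc.trans hpeak
  have hC0 : 0 ≤ C := by rw [hC]; positivity
  have hcard : Fintype.card (Fin n₁ ⊕ Fin n₂) = n₁ + n₂ := by simp
  have hexcess : ∀ᵐ ω ∂Pr, d < FluidQueue.virtualDelay (A₁ ω) (D₁ ω) t →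
      ∃ s, 0 ≤ s ∧ s ≤ t - d ∧ C * d <
        (∫ u in s..(t - d), FluidQueue.inputRate peak Z ω u) - C * (t - d - s) := by
    filter_upwards [hserver, ae_all_iff.mpr fun i => (hZ i).paths] with ω hω hpath hlt
    have hint : ∀ s v, 0 ≤ s → s ≤ v →
        IntervalIntegrable (FluidQueue.inputRate peak Z ω) volume s v := fun s v hs hsv =>
      FluidQueue.intervalIntegrable_of_rightContinuous
        (fun u _ => FluidQueue.continuousWithinAt_inputRate (fun i t => (hpath i t).1) u)
        (FluidQueue.abs_inputRate_le hpk.le ω) hs hsv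
    have hsum : ∀ v, 0 ≤ v →
        A₁ ω v + A₂ ω v = ∫ u in (0 : ℝ)..v, FluidQueue.inputRate peak Z ω u := by
      intro v hv
      rw [hA₁, hA₂, FluidQueue.arrivals, FluidQueue.arrivals, ← intervalIntegral.integral_add]
      · refine intervalIntegral.integral_congr fun u _ => ?_
        simp only [FluidQueue.aggregate, FluidQueue.inputRate, Fintype.sum_sum_type]
        push_cast
        ring
      · have : IntervalIntegrable (fun u => FluidQueue.inputRate peak (fun i => Z (Sum.inl i)) ω u)
            volume 0 v := FluidQueue.intervalIntegrable_of_rightContinuous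
          (fun u _ => FluidQueue.continuousWithinAt_inputRate (Z := fun i => Z (Sum.inl i))
            (fun i t => (hpath (Sum.inl i) t).1) u)
          (FluidQueue.abs_inputRate_le hpk.le ω) le_rfl hv
        simpa only [FluidQueue.aggregate, FluidQueue.inputRate, Nat.cast_sum] using this
      · have : IntervalIntegrable (fun u => FluidQueue.inputRate peak (fun i => Z (Sum.inr i)) ω u)
            volume 0 v := FluidQueue.intervalIntegrable_of_rightContinuous
          (fun u _ => FluidQueue.continuousWithinAt_inputRate (Z := fun i => Z (Sum.inr i))
            (fun i t => (hpath (Sum.inr i) t).1) u)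
          (FluidQueue.abs_inputRate_le hpk.le ω) le_rfl hv
        simpa only [FluidQueue.aggregate, FluidQueue.inputRate, Nat.cast_sum] using this
    have hdiff : ∀ s v, 0 ≤ s → s ≤ v → A₁ ω v + A₂ ω v - (A₁ ω s + A₂ ω s) =
        ∫ u in s..v, FluidQueue.inputRate peak Z ω u := by
      intro s v hs hsv
      rw [hsum v (hs.trans hsv), hsum s hs,
        ← intervalIntegral.integral_add_adjacent_intervals (hint 0 s le_rfl hs) (hint s v hs hsv),
        add_sub_cancel_left]
    have ht : 0 ≤ t := hd.trans hdt
    have hcont : ContinuousOn (fun u => A₁ ω u + A₂ ω u) (Set.Icc 0 t) := by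
      have := intervalIntegral.continuousOn_primitive_interval
        ((intervalIntegrable_iff' (by simp)).mp (hint 0 t le_rfl ht))
      rw [Set.uIcc_of_le ht] at this
      exact this.congr fun u hu => hsum u hu.1
    obtain ⟨s, hs0, hsT, hs⟩ := hω.exists_lt_of_lt_virtualDelay
      (by rw [hA₁]; exact intervalIntegral.integral_same)
      (by rw [hA₂]; exact intervalIntegral.integral_same) hC0
      (fun u v hu huv => by
        have := intervalIntegral.integral_nonneg (μ := volume) huv fun w _ =>
          FluidQueue.inputRate_nonneg (Z := Z) hpk.le ω w
        have := hdiff u v hu huv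
        linarith) hcont hd hdt hlt
    exact ⟨s, hs0, hsT, by rwa [hdiff s (t - d) hs0 hsT] at hs⟩
  have hmono : Pr.real {ω | d < FluidQueue.virtualDelay (A₁ ω) (D₁ ω) t} ≤
      Pr.real {ω | ∃ s, 0 ≤ s ∧ s ≤ t - d ∧ C * d <
        (∫ u in s..(t - d), FluidQueue.inputRate peak Z ω u) - C * (t - d - s)} :=
    ENNReal.toReal_mono (measure_ne_top _ _) (measure_mono_ae hexcess)
  refine hmono.trans ?_
  -- For d = t the horizon t - d is zero and there is no grid; the excess over a degenerate interval
  -- is zero, so the event is empty.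
  rcases hdt.eq_or_lt with rfl | hdt
  · have hempty : {ω | ∃ s, 0 ≤ s ∧ s ≤ d - d ∧ C * d <
        (∫ u in s..(d - d), FluidQueue.inputRate peak Z ω u) - C * (d - d - s)} = ∅ := by
      ext ω
      simp only [Set.mem_ofPred_eq, Set.mem_empty_iff_false, iff_false, sub_self]
      rintro ⟨s, hs0, hs, hlt⟩
      rw [le_antisymm hs hs0, intervalIntegral.integral_same] at hlt
      have := mul_nonneg hC0 hd
      linarith
    rw [hempty, measureReal_empty]
    rw [FluidQueue.boundK_eq hmu hlam hc hpeak]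
    have := FluidQueue.one_lt_onWeight hmu hlam hc hpeak hρ
    have h1 : 0 ≤ 1 - FluidQueue.onProb mu lam := FluidQueue.onOffDist_nonneg hmu hlam 0
    have h2 : 0 ≤ FluidQueue.onProb mu lam := FluidQueue.onOffDist_nonneg hmu hlam 1
    positivity
  · have h := FluidQueue.measureReal_backlog_le hmu hlam hc hZ hindep hρ hpeak (sub_pos.mpr hdt)
      (mul_nonneg hC0 hd)
    rwa [hcard, ← hC, ← mul_assoc] at h
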